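/- All systems are finite-dimensional. A bipartite LOCC protocol from $\mathbb{C}^a\otimes\mathbb{C}^b$ to $\mathbb{C}^x\otimes\mathbb{C}^y$ is a finite tree of rounds. In each round one party (Alice on the first factor, Bob on the second) applies a local quantum instrument, given by Kraus operators $K_{o,i}$ with $\sum_{o,i}K_{o,i}^\dagger K_{o,i}=1$, whose announced outcome $o\in\{0,1\}^m$ is sent to the other party. Here $m=0$ is allowed (a local operation without communication), the dimension of the output system is arbitrary (so that ancillas can be added or discarded and unannounced results kept as local registers), and everything that follows, including who acts next, may depend on the messages sent so far. The cost of the protocol is the maximum, over all sequences of messages, of the total number of bits sent in both directions. For a given input state, the output distribution assigns to each transcript $t$ (complete sequence of messages) the unnormalised output state $\sigma_t$ on $\mathbb{C}^x\otimes\mathbb{C}^y$; $\operatorname{Tr}\sigma_t$ is the probability of $t$, and $\sigma_t/\operatorname{Tr}\sigma_t$ is the final state given $t$. **Claim.** Let $|\psi\rangle\in\mathbb{C}^a\otimes\mathbb{C}^b$ be a unit vector, and let $P$ be an LOCC protocol from $\mathbb{C}^a\otimes\mathbb{C}^b$ to $\mathbb{C}^x\otimes\mathbb{C}^y$ of cost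 at most $c$. Then there is an LOCC protocol $S$ of cost $c$, with the same input and output systems, of the following form: 1. Alice performs on her half of the input a generalized measurement $\{M_k\}_{k\in\{0,1\}^c}$ with operators $M_k:\mathbb{C}^a\to\mathbb{C}^x\otimes\mathcal{A}'$, $\sum_k M_k^\dagger M_k=1$ (hence with at most $2^c$ outcomes); 2. she sends the whole outcome $k$ to Bob, using $c$ bits; 3. Bob adds an ancilla $\mathcal{B}_0$ in a fixed pure state and applies a unitary $U_k:\mathbb{C}^b\otimes\mathcal{B}_0\to\mathbb{C}^y\otimes\mathcal{B}'$ depending on $k$; 4. Alice and Bob discard $\mathcal{A}'$ and $\mathcal{B}'$, respectively. On the input $|\psi\rangle\langle\psi|$, $S$ has the same output distribution as $P$: there is an injective map $e$ from the transcripts of $P$ to those of $S$ such that for every transcript $t$ of $P$ the unnormalised output state of $S$ at $e(t)$ equals that of $P$ at $t$, while every transcript of $S$ outside the image of $e$ has unnormalised output state $0$ (it occurs with probability $0$). -/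

import Mathlib

open scoped Matrix Kronecker

noncomputable section

namespace LOCC

/-- Messages of `m` classical bits. -/
abbrev Msg (m : ℕ) : Type := Fin m → Bool

/-- A local operation (quantum instrument) on a `d`-dimensional system whose classical outcome `o`
is a string of `m` bits, in Kraus form.  Upon outcome `o` the system is left in a system of
dimension `d' o`, and the (unnormalised) state is transformed by the completely positive map with
Kraus operators `K o i`.  The case `m = 0` is a local quantum channel.  Measurement results that
are not announced are recorded in the (arbitrary) output system of the operation. -/
structure LocalOp (m d : ℕ) (d' : Msg m → ℕ) where
  rk : Msg m → ℕ
  K : (o : Msg m) → Fin (rk o) → Matrix (Fin (d' o)) (Fin d) ℂ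
  complete : ∑ o, ∑ i, (K o i)ᴴ * K o i = 1

/-- The action of outcome `o` of a local operation of Alice on a bipartite state. -/
def LocalOp.onAlice {m a b : ℕ} {a' : Msg m → ℕ} (L : LocalOp m a a') (o : Msg m)
    (ρ : Matrix (Fin a × Fin b) (Fin a × Fin b) ℂ) :
    Matrix (Fin (a' o) × Fin b) (Fin (a' o) × Fin b) ℂ :=
  ∑ i, (L.K o i ⊗ₖ (1 : Matrix (Fin b) (Fin b) ℂ)) * ρ *
    (L.K o i ⊗ₖ (1 : Matrix (Fin b) (Fin b) ℂ))ᴴ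

/-- The action of outcome `o` of a local operation of Bob on a bipartite state. -/
def LocalOp.onBob {m a b : ℕ} {b' : Msg m → ℕ} (L : LocalOp m b b') (o : Msg m)
    (ρ : Matrix (Fin a × Fin b) (Fin a × Fin b) ℂ) :
    Matrix (Fin a × Fin (b' o)) (Fin a × Fin (b' o)) ℂ :=
  ∑ i, ((1 : Matrix (Fin a) (Fin a) ℂ) ⊗ₖ L.K o i) * ρ *
    ((1 : Matrix (Fin a) (Fin a) ℂ) ⊗ₖ L.K o i)ᴴ

/-- LOCC protocols taking a bipartite `a × b` system to a bipartite `x × y` system.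
In each round one party performs a local operation and sends its `m`-bit outcome to the
other party (`m = 0` is a local operation without communication).  Everything that happens
afterwards, including who acts next, may depend on the messages sent so far. -/
inductive Protocol (x y : ℕ) : ℕ → ℕ → Type
  | done : Protocol x y x y
  | alice {a b m : ℕ} {a' : Msg m → ℕ} (L : LocalOp m a a')
      (next : (o : Msg m) → Protocol x y (a' o) b) : Protocol x y a b
  | bob {a b m : ℕ} {b' : Msg m → ℕ} (L : LocalOp m b b')
      (next : (o : Msg m) → Protocol x y a (b' o)) : Protocol x y a b

namespace Protocol

/-- Total number of bits of classical communication, in both directions, in the worst case. -/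
def cost {x y : ℕ} : {a b : ℕ} → Protocol x y a b → ℕ
  | _, _, done => 0
  | _, _, alice (m := m) _ next => m + Finset.univ.sup fun o => (next o).cost
  | _, _, bob (m := m) _ next => m + Finset.univ.sup fun o => (next o).cost

/-- The complete records of the messages sent in a run of the protocol. -/
def Transcript {x y : ℕ} : {a b : ℕ} → Protocol x y a b → Type
  | _, _, done => Unit
  | _, _, alice (m := m) _ next => Σ o : Msg m, (next o).Transcript
  | _, _, bob (m := m) _ next => Σ o : Msg m, (next o).Transcript

/-- The unnormalised output state of the protocol for a given transcript, on input `ρ`: its trace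
is the probability of the transcript, and, if this is not zero, dividing by the trace gives the
final state conditioned on the transcript. -/
def output {x y : ℕ} : {a b : ℕ} → (P : Protocol x y a b) →
    Matrix (Fin a × Fin b) (Fin a × Fin b) ℂ → P.Transcript →
    Matrix (Fin x × Fin y) (Fin x × Fin y) ℂ
  | _, _, done => fun ρ _ => ρ
  | _, _, alice (m := m) L next => fun ρ (t : Σ o : Msg m, (next o).Transcript) =>
      (next t.1).output (L.onAlice t.1 ρ) t.2
  | _, _, bob (m := m) L next => fun ρ (t : Σ o : Msg m, (next o).Transcript) =>
      (next t.1).output (L.onBob t.1 ρ) t.2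

end Protocol

/-- The embedding `v ↦ v ⊗ |i⟩` of a `d`-dimensional system into its tensor product with an
`n`-dimensional one; `Fin (d * n)` indexes the product basis through `finProdFinEquiv`. -/
def tensorBasis (d : ℕ) {n : ℕ} (i : Fin n) : Matrix (Fin (d * n)) (Fin d) ℂ :=
  Matrix.of fun t s => if t = finProdFinEquiv (s, i) then 1 else 0

theorem tensorBasis_isometry (d : ℕ) {n : ℕ} (i : Fin n) :
    (tensorBasis d i)ᴴ * tensorBasis d i = 1 := by
  ext s s'
  simp [Matrix.mul_apply, tensorBasis, Matrix.one_apply, eq_comm]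

theorem tensorBasis_complete (d n : ℕ) :
    ∑ i : Fin n, tensorBasis d i * (tensorBasis d i)ᴴ = 1 := by
  ext t t'
  obtain ⟨⟨s, j⟩, rfl⟩ := finProdFinEquiv.surjective t
  obtain ⟨⟨s', j'⟩, rfl⟩ := finProdFinEquiv.surjective t'
  simp only [Matrix.sum_apply, Matrix.mul_apply, tensorBasis, Matrix.conjTranspose_apply,
    Matrix.of_apply, EmbeddingLike.apply_eq_iff_eq, Prod.mk.injEq, Matrix.one_apply]
  rw [Finset.sum_eq_single j (by intro i _ hi; simp [Ne.symm hi]) (by simp),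
    Finset.sum_eq_single s (by intro i _ hi; simp [Ne.symm hi]) (by simp)]
  by_cases h : s = s' <;> by_cases h' : j = j' <;> simp [h, h', eq_comm]

namespace LocalOp

/-- A generalised measurement with operators `M k`, `∑ k, (M k)ᴴ * M k = 1`; its outcome is `k`. -/
def measurement {m d d' : ℕ} (M : Msg m → Matrix (Fin d') (Fin d) ℂ)
    (hM : ∑ k, (M k)ᴴ * M k = 1) : LocalOp m d (fun _ => d') where
  rk _ := 1
  K k _ := M k
  complete := by simpa using hM

/-- An isometry, applied without communication. -/
def isometry {d d' : ℕ} (V : Matrix (Fin d') (Fin d) ℂ) (hV : Vᴴ * V = 1) :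
    LocalOp 0 d (fun _ => d') where
  rk _ := 1
  K _ _ := V
  complete := by simpa using hV

/-- Adding an ancilla of dimension `n` prepared in the basis state `|i⟩`. -/
def addAncilla (d : ℕ) {n : ℕ} (i : Fin n) : LocalOp 0 d (fun _ => d * n) :=
  isometry (tensorBasis d i) (tensorBasis_isometry d i)

/-- Discarding (tracing out) an ancilla of dimension `n`. -/
def discard (d n : ℕ) : LocalOp 0 (d * n) (fun _ => d) where
  rk _ := n
  K _ i := (tensorBasis d i)ᴴ
  complete := by simpa using tensorBasis_complete d n

end LocalOp

/-- The data of a protocol in standard form with `c` bits of communication. -/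
structure StandardForm (x y a b c : ℕ) where
  /-- dimension of the ancilla that Alice discards in the end -/
  aliceAnc : ℕ
  /-- dimension of the ancilla that Bob discards in the end -/
  bobAnc : ℕ
  /-- dimension of the ancilla that Bob adds -/
  bobInit : ℕ
  /-- the basis state in which Bob prepares it -/
  init : Fin bobInit
  /-- Alice's generalised measurement on her half of the input, with outcomes in `Msg c` -/
  M : Msg c → Matrix (Fin (x * aliceAnc)) (Fin a) ℂ
  M_complete : ∑ k, (M k)ᴴ * M k = 1
  /-- Bob's unitary operations; input and output space are the same space, factorised once as
  (input system) ⊗ (added ancilla) and once as (output system) ⊗ (discarded ancilla) -/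
  U : Msg c → Matrix (Fin (y * bobAnc)) (Fin (b * bobInit)) ℂ
  U_left : ∀ k, (U k)ᴴ * U k = 1
  U_right : ∀ k, U k * (U k)ᴴ = 1

/-- Alice measures `{M k}` and sends the whole outcome `k` to Bob; Bob adds his ancilla and applies
the unitary `U k`; both discard their ancillas. -/
def StandardForm.toProtocol {x y a b c : ℕ} (S : StandardForm x y a b c) : Protocol x y a b :=
  .alice (LocalOp.measurement S.M S.M_complete) fun k =>
  .bob (LocalOp.addAncilla b S.init) fun _ =>
  .bob (LocalOp.isometry (S.U k) (S.U_left k)) fun _ =>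
  .alice (LocalOp.discard x S.aliceAnc) fun _ =>
  .bob (LocalOp.discard y S.bobAnc) fun _ =>
  .done

/-- The density matrix `|ψ⟩⟨ψ|`. -/
def pureState {a b : ℕ} (ψ : Fin a × Fin b → ℂ) : Matrix (Fin a × Fin b) (Fin a × Fin b) ℂ :=
  Matrix.vecMulVec ψ (star ψ)

end LOCC

end

/-!
Write a vector as a matrix `Ψ`, with Alice's index on the rows and Bob's on the columns, so that
operators `A` of Alice and `B` of Bob turn it into `A * Ψ * Bᵀ`. Keeping Kraus indices in the
ancillas keeps the state pure in every round. If Bob measures `B i`, then Alice's state `Ψ * Ψᴴ` is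
the sum of her states after the several outcomes, and Douglas' factorisation lemma gives operators
`N i` of Alice that produce the same states of hers with the same probabilities. Purifications of
the same state differ by an operator of Bob, so `Ψ * (B i)ᵀ = N i * Ψ * (V i)ᵀ`: Alice can measure
in Bob's place, and Bob only has to apply the correction `V i`. By induction on the protocol, Alice
makes a single measurement, whose outcome is the transcript, and a protocol of cost `c` has at most
`2 ^ c` of these.

The operators found in this way are in general only contractions. Since they already account for
the total probability, completing them to a measurement and to isometries, in new parts of the
ancillas, adds nothing to the output. Finally, Bob's isometries extend to unitaries.
-/

noncomputable section

open scoped MatrixOrder ComplexOrder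

namespace LOCC

section Factorization

variable {ι l m n : Type*} {κ : ι → Type*} [Fintype ι] [∀ i, Fintype (κ i)]

theorem gram_nonneg [Fintype m] [Finite n] (A : Matrix m n ℂ) : 0 ≤ Aᴴ * A :=
  (Matrix.posSemidef_conjTranspose_mul_self A).nonneg

theorem conjTranspose_mul_mul_mono [Fintype n] [Finite l] {A B : Matrix n n ℂ} (h : A ≤ B)
    (C : Matrix n l ℂ) : Cᴴ * A * C ≤ Cᴴ * B * C := by
  have hC := (Matrix.le_iff.1 h).conjTranspose_mul_mul_same C
  rwa [Matrix.mul_sub, Matrix.sub_mul, ← Matrix.le_iff] at hC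

theorem sum_gram_mul [Fintype n] (A : ∀ i, Matrix (κ i) n ℂ) (C : Matrix n l ℂ) :
    ∑ i, (A i * C)ᴴ * (A i * C) = Cᴴ * (∑ i, (A i)ᴴ * A i) * C := by
  simp only [Matrix.mul_sum, Matrix.sum_mul, Matrix.conjTranspose_mul, Matrix.mul_assoc]

theorem sum_gram_mul_le [Fintype n] [DecidableEq n] [Finite l] {A : ∀ i, Matrix (κ i) n ℂ}
    (hA : ∑ i, (A i)ᴴ * A i ≤ 1) (C : Matrix n l ℂ) :
    ∑ i, (A i * C)ᴴ * (A i * C) ≤ Cᴴ * C := by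
  simpa only [sum_gram_mul, Matrix.mul_one] using conjTranspose_mul_mul_mono hA C

theorem gram_mul_le_one [Fintype l] [Fintype m] [Finite n] [DecidableEq m] [DecidableEq n]
    {A : Matrix l m ℂ} {B : Matrix m n ℂ} (hA : Aᴴ * A ≤ 1) (hB : Bᴴ * B ≤ 1) :
    (A * B)ᴴ * (A * B) ≤ 1 := by
  calc (A * B)ᴴ * (A * B) = Bᴴ * (Aᴴ * A) * B := by
        simp only [Matrix.conjTranspose_mul, Matrix.mul_assoc]
    _ ≤ Bᴴ * 1 * B := conjTranspose_mul_mul_mono hA B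
    _ ≤ 1 := by rwa [Matrix.mul_one]

theorem conjTranspose_transpose_conjTranspose (A : Matrix m n ℂ) : Aᴴᵀᴴ = Aᵀ := by
  ext
  simp

theorem gram_conjTranspose_transpose [Fintype m] (A : Matrix m n ℂ) : Aᴴᵀᴴ * Aᴴᵀ = (Aᴴ * A)ᵀ := by
  rw [conjTranspose_transpose_conjTranspose, Matrix.transpose_mul]

theorem transpose_le_one [DecidableEq n] {A : Matrix n n ℂ} (h : A ≤ 1) : Aᵀ ≤ 1 := by
  have hA := (Matrix.le_iff.1 h).transpose
  rwa [Matrix.transpose_sub, Matrix.transpose_one, ← Matrix.le_iff] at hA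

theorem exists_hermitian_pseudoinverse [Fintype n] {G : Matrix n n ℂ} (hG : G.IsHermitian) :
    ∃ H : Matrix n n ℂ, H.IsHermitian ∧ G * H * G = G ∧ H * G * H = H := by
  classical
  have hG' : IsSelfAdjoint G := hG
  have hmul (f g : ℝ → ℝ) : cfc f G * cfc g G = cfc (fun x => f x * g x) G :=
    (cfc_mul f g G (G.finite_real_spectrum.continuousOn _)
      (G.finite_real_spectrum.continuousOn _)).symm
  have hid : cfc (fun x : ℝ => x) G = G := cfc_id' ℝ G
  set H := cfc (fun x : ℝ => x⁻¹) G
  refine ⟨H, cfc_predicate _ G, ?_, ?_⟩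
  · calc G * H * G = cfc (fun x : ℝ => x * x⁻¹ * x) G := by rw [← hmul, ← hmul, hid]
      _ = G := by simp only [mul_inv_mul_cancel, hid]
  · have hinv (x : ℝ) : x⁻¹ * x * x⁻¹ = x⁻¹ := by simpa using mul_inv_mul_cancel x⁻¹
    calc H * G * H = cfc (fun x : ℝ => x⁻¹ * x * x⁻¹) G := by rw [← hmul, ← hmul, hid]
      _ = H := by simp only [hinv, H]

/-- Douglas' factorisation lemma. With a pseudoinverse `H` of `G = Yᴴ * Y`, the operators
`X i * H * Yᴴ` do it: the bound by `G` makes `X i` vanish on the kernel of `G`, and `Y * H * Yᴴ` is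
a projection. -/
theorem exists_mul_eq_of_sum_gram_le [Fintype m] [DecidableEq m] [Finite n]
    {X : ∀ i, Matrix (κ i) n ℂ} {Y : Matrix m n ℂ} (h : ∑ i, (X i)ᴴ * X i ≤ Yᴴ * Y) :
    ∃ C : ∀ i, Matrix (κ i) m ℂ, ∑ i, (C i)ᴴ * C i ≤ 1 ∧ ∀ i, C i * Y = X i := by
  classical
  have := Fintype.ofFinite n
  obtain ⟨H, hH, hGHG, hHGH⟩ :=
    exists_hermitian_pseudoinverse (Matrix.isHermitian_conjTranspose_mul_self Y)
  set G := Yᴴ * Y with hG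
  have hker : ∀ i, X i * (1 - H * G) = 0 := by
    have hsum : ∑ i, (X i * (1 - H * G))ᴴ * (X i * (1 - H * G)) ≤ 0 := by
      have hGE : G * (1 - H * G) = 0 := by
        rw [Matrix.mul_sub, Matrix.mul_one, ← Matrix.mul_assoc, hGHG, sub_self]
      rw [sum_gram_mul]
      refine (conjTranspose_mul_mul_mono h _).trans_eq ?_
      rw [Matrix.mul_assoc, hGE, Matrix.mul_zero]
    have hnonneg := fun i => gram_nonneg (X i * (1 - H * G))
    have hzero := (Finset.sum_eq_zero_iff_of_nonneg fun i _ => hnonneg i).1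
      (hsum.antisymm (Finset.sum_nonneg fun i _ => hnonneg i))
    exact fun i => Matrix.conjTranspose_mul_self_eq_zero.1 (hzero i (Finset.mem_univ i))
  refine ⟨fun i => X i * (H * Yᴴ), ?_, fun i => ?_⟩
  · have hproj : IsStarProjection (Y * H * Yᴴ) :=
      ⟨calc Y * H * Yᴴ * (Y * H * Yᴴ) = Y * (H * G * H) * Yᴴ := by
              simp only [hG, Matrix.mul_assoc]
          _ = Y * H * Yᴴ := by rw [hHGH],
        Matrix.isHermitian_mul_mul_conjTranspose Y hH⟩
    calc ∑ i, (X i * (H * Yᴴ))ᴴ * (X i * (H * Yᴴ)) ≤ (H * Yᴴ)ᴴ * G * (H * Yᴴ) := by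
          rw [sum_gram_mul]
          exact conjTranspose_mul_mul_mono h _
      _ = Y * (H * G * H) * Yᴴ := by
          simp only [Matrix.conjTranspose_mul, Matrix.conjTranspose_conjTranspose, hH.eq,
            Matrix.mul_assoc]
      _ ≤ 1 := by
          rw [hHGH]
          exact hproj.le_one
  · have hX := hker i
    rw [Matrix.mul_sub, Matrix.mul_one, sub_eq_zero] at hX
    simpa only [Matrix.mul_assoc] using hX.symm

theorem exists_mul_eq_of_gram_eq [Fintype l] [Fintype m] [DecidableEq m] [Finite n]
    {X : Matrix l n ℂ} {Y : Matrix m n ℂ} (h : Xᴴ * X = Yᴴ * Y) :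
    ∃ C : Matrix l m ℂ, Cᴴ * C ≤ 1 ∧ C * Y = X := by
  obtain ⟨C, hC, hCY⟩ := exists_mul_eq_of_sum_gram_le (ι := Unit) (X := fun _ => X) (Y := Y)
    (by simpa using h.le)
  exact ⟨C (), by simpa using hC, hCY ()⟩

theorem exists_hermitian_mul_self_eq [Fintype n] {A : Matrix n n ℂ} (hA : 0 ≤ A) :
    ∃ T : Matrix n n ℂ, Tᴴ = T ∧ T * T = A := by
  classical
  exact ⟨CFC.sqrt A, (CFC.sqrt_nonneg A).isSelfAdjoint, CFC.sqrt_mul_sqrt_self A hA⟩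

theorem exists_mul_gram_mul_conjTranspose_eq [Fintype m] [DecidableEq m] [Fintype n]
    {X : ∀ i, Matrix (κ i) m ℂ} {Y : Matrix n m ℂ} (h : ∑ i, (X i)ᴴ * X i ≤ Yᴴ * Y) :
    ∃ N : ι → Matrix m m ℂ, ∑ i, (N i)ᴴ * N i ≤ 1 ∧
      ∀ i, N i * (Yᴴ * Y) * (N i)ᴴ = (X i)ᴴ * X i := by
  choose T hT hTX using fun i => exists_hermitian_mul_self_eq (gram_nonneg (X i))
  obtain ⟨S, hS, hSY⟩ := exists_hermitian_mul_self_eq (gram_nonneg Y)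
  obtain ⟨N, hN, hNS⟩ := exists_mul_eq_of_sum_gram_le (X := T) (Y := S)
    (by simpa only [hT, hTX, hS, hSY] using h)
  refine ⟨N, hN, fun i => ?_⟩
  calc N i * (Yᴴ * Y) * (N i)ᴴ = (N i * S) * (N i * S)ᴴ := by
        rw [← hSY, Matrix.conjTranspose_mul, hS]
        simp only [Matrix.mul_assoc]
    _ = (X i)ᴴ * X i := by rw [hNS, hT, hTX]

/-- The `N i` are chosen so that `X = Ψ * (B i)ᵀ` and `X = N i * Ψ` give Alice the same state
`X * Xᴴ`, hence differ by an operator of Bob. -/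
theorem exists_swap_measurement [Fintype m] [DecidableEq m] [Fintype n] [DecidableEq n]
    (Ψ : Matrix m n ℂ) {B : ∀ i, Matrix (κ i) n ℂ} (hB : ∑ i, (B i)ᴴ * B i ≤ 1) :
    ∃ (N : ι → Matrix m m ℂ) (V : ∀ i, Matrix (κ i) n ℂ), ∑ i, (N i)ᴴ * N i ≤ 1 ∧
      (∀ i, (V i)ᴴ * V i ≤ 1) ∧ ∀ i, Ψ * (B i)ᵀ = N i * Ψ * (V i)ᵀ := by
  have hρ : ∑ i, ((B i)ᴴᵀ * Ψᴴ)ᴴ * ((B i)ᴴᵀ * Ψᴴ) ≤ Ψᴴᴴ * Ψᴴ :=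
    sum_gram_mul_le (by
      simpa only [gram_conjTranspose_transpose, Matrix.transpose_sum] using transpose_le_one hB) Ψᴴ
  obtain ⟨N, hN, hNρ⟩ := exists_mul_gram_mul_conjTranspose_eq hρ
  choose C hC hCN using fun i => exists_mul_eq_of_gram_eq (X := (B i)ᴴᵀ * Ψᴴ) (Y := (N i * Ψ)ᴴ)
    (by simpa only [Matrix.conjTranspose_mul, Matrix.conjTranspose_conjTranspose, Matrix.mul_assoc]
      using (hNρ i).symm)
  refine ⟨N, fun i => (C i)ᴴᵀ, hN, fun i => ?_, fun i => ?_⟩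
  · rw [gram_conjTranspose_transpose]
    exact transpose_le_one (hC i)
  · simpa [conjTranspose_transpose_conjTranspose] using congrArg Matrix.conjTranspose (hCN i).symm

end Factorization

section Isometry

theorem exists_nonempty_of_sum_gram_eq_one {ι n : Type*} {κ : ι → Type*} [Fintype ι]
    [∀ i, Fintype (κ i)] [DecidableEq n] [Nonempty n] {A : ∀ i, Matrix (κ i) n ℂ}
    (hA : ∑ i, (A i)ᴴ * A i = 1) : ∃ i, Nonempty (κ i) := by
  by_contra! h
  have hzero : (1 : Matrix n n ℂ) = 0 := by
    rw [← hA]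
    exact Finset.sum_eq_zero fun i _ => by ext; simp [Matrix.mul_apply]
  obtain ⟨j⟩ := ‹Nonempty n›
  simpa using congrFun₂ hzero j j

theorem orthonormal_col_iff {m n : Type*} [Fintype m] [DecidableEq n] {W : Matrix m n ℂ} :
    Orthonormal ℂ (fun j => WithLp.toLp 2 (W.col j)) ↔ Wᴴ * W = 1 := by
  rw [orthonormal_iff_ite, ← Matrix.ext_iff]
  simp [Matrix.mul_apply, Matrix.one_apply, PiLp.inner_apply, mul_comm]

theorem exists_unitary_extension {m n N : Type*} [Fintype m] [DecidableEq m] [DecidableEq n]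
    [Fintype N] [DecidableEq N] {W : Matrix m n ℂ} (hW : Wᴴ * W = 1) (f : n ↪ N)
    (hN : Fintype.card m = Fintype.card N) :
    ∃ U : Matrix m N ℂ, Uᴴ * U = 1 ∧ U * Uᴴ = 1 ∧ U.submatrix id f = W := by
  let v : N → EuclideanSpace ℂ m := Function.extend f (fun j => WithLp.toLp 2 (W.col j)) 0
  have hv (j : n) : v (f j) = WithLp.toLp 2 (W.col j) := f.injective.extend_apply _ _ _
  have horth : Orthonormal ℂ ((Set.range f).domRestrict v) := by
    convert (orthonormal_col_iff.2 hW).comp _ (Equiv.ofInjective f f.injective).symm.injective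
      using 1
    funext ⟨_, j, rfl⟩
    simp [hv]
  obtain ⟨u, hu⟩ := horth.exists_orthonormalBasis_extension_of_card_eq (by simpa using hN)
  let U : Matrix m N ℂ := Matrix.of fun i j => u j i
  have hU : Uᴴ * U = 1 := orthonormal_col_iff.1 u.orthonormal
  refine ⟨U, hU, (Matrix.mul_eq_one_comm_of_card_eq _ _ _ hN).2 hU, ?_⟩
  ext i j
  simp [U, hu _ ⟨j, rfl⟩, hv]

end Isometry

section Ancilla

variable {ι X Y R R' S S' m n : Type*} {κ : ι → Type*}

/-- The coefficients of a vector on `(X ⊗ R) ⊗ (Y ⊗ R')`, regrouped along the cut between the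
systems `X ⊗ Y` and the ancillas `R ⊗ R'`. -/
def regroup (Φ : Matrix (X × R) (Y × R') ℂ) : Matrix (X × Y) (R × R') ℂ :=
  Matrix.of fun p r => Φ (p.1, r.1) (p.2, r.2)

/-- The state of `X ⊗ Y` after discarding the ancillas `R` and `R'` of Alice and Bob from the pure
state with coefficient matrix `Φ`, whose rows belong to Alice and whose columns belong to Bob. -/
def reduced [Fintype R] [Fintype R'] (Φ : Matrix (X × R) (Y × R') ℂ) :
    Matrix (X × Y) (X × Y) ℂ :=
  regroup Φ * (regroup Φ)ᴴ

theorem reduced_apply [Fintype R] [Fintype R'] (Φ : Matrix (X × R) (Y × R') ℂ) (p q : X × Y) :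
    reduced Φ p q = ∑ r, ∑ r', Φ (p.1, r) (p.2, r') * star (Φ (q.1, r) (q.2, r')) := by
  simp only [reduced, regroup, Matrix.mul_apply, Fintype.sum_prod_type, Matrix.of_apply,
    Matrix.conjTranspose_apply]

theorem reduced_zero [Fintype R] [Fintype R'] :
    reduced (0 : Matrix (X × R) (Y × R') ℂ) = 0 := by
  ext
  simp [reduced_apply]

theorem reduced_nonneg [Finite X] [Finite Y] [Fintype R] [Fintype R']
    (Φ : Matrix (X × R) (Y × R') ℂ) : 0 ≤ reduced Φ :=
  (Matrix.posSemidef_self_mul_conjTranspose _).nonneg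

theorem trace_reduced [Fintype X] [Fintype Y] [Fintype R] [Fintype R']
    (Φ : Matrix (X × R) (Y × R') ℂ) : (reduced Φ).trace = (Φᴴ * Φ).trace := by
  have hswap : ∑ p, ∑ q, Φ p q * star (Φ p q) = (Φᴴ * Φ).trace := by
    rw [Finset.sum_comm]
    simp [Matrix.trace, Matrix.mul_apply, mul_comm]
  rw [← hswap]
  simp only [Matrix.trace, Matrix.diag_apply, reduced_apply, Fintype.sum_prod_type]
  exact Finset.sum_congr rfl fun x _ => Finset.sum_comm

theorem kronecker_conj_reduced {X' Y' : Type*} [Fintype X] [Fintype Y] [Fintype R] [Fintype R']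
    [DecidableEq R] [DecidableEq R'] (A : Matrix X' X ℂ) (B : Matrix Y' Y ℂ)
    (Φ : Matrix (X × R) (Y × R') ℂ) :
    (A ⊗ₖ B) * reduced Φ * (A ⊗ₖ B)ᴴ =
      reduced ((A ⊗ₖ (1 : Matrix R R ℂ)) * Φ * (B ⊗ₖ (1 : Matrix R' R' ℂ))ᵀ) := by
  have hregroup : regroup ((A ⊗ₖ (1 : Matrix R R ℂ)) * Φ * (B ⊗ₖ (1 : Matrix R' R' ℂ))ᵀ) =
      (A ⊗ₖ B) * regroup Φ := by
    ext p r
    calc _ = ∑ v, ∑ u, A p.1 u * Φ (u, r.1) (v, r.2) * B p.2 v := by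
          simp [regroup, Matrix.mul_apply, Matrix.one_apply, Fintype.sum_prod_type, Finset.sum_mul]
      _ = ∑ u, ∑ v, A p.1 u * B p.2 v * Φ (u, r.1) (v, r.2) := by
          rw [Finset.sum_comm]
          simp only [mul_right_comm]
      _ = _ := by simp [regroup, Matrix.mul_apply, Fintype.sum_prod_type]
  rw [reduced, reduced, hregroup, Matrix.conjTranspose_mul]
  simp only [Matrix.mul_assoc]

theorem reduced_reindex [Fintype R] [Fintype R'] [Fintype S] [Fintype S'] (e : S ≃ R) (f : S' ≃ R')
    (Φ : Matrix (X × R) (Y × R') ℂ) :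
    reduced (Φ.submatrix (Prod.map id e) (Prod.map id f)) = reduced Φ := by
  ext p q
  simp only [reduced_apply, Matrix.submatrix_apply, Prod.map_apply, id]
  rw [← e.sum_comp]
  exact Finset.sum_congr rfl fun r _ => f.sum_comp fun r' =>
    Φ (p.1, e r) (p.2, r') * star (Φ (q.1, e r) (q.2, r'))

/-- A family of operators with a common output system `X`, with its index recorded in the
ancilla. -/
def ancillaSigma (A : ∀ i, Matrix (X × κ i) n ℂ) : Matrix (X × Σ i, κ i) n ℂ :=
  Matrix.of fun p => A p.2.1 (p.1, p.2.2)

/-- Two operators with a common output system `X`, placed in complementary parts of the ancilla. -/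
def ancillaSum (A : Matrix (X × R) n ℂ) (B : Matrix (X × S) n ℂ) : Matrix (X × (R ⊕ S)) n ℂ :=
  Matrix.of fun p => p.2.elim (fun r => A (p.1, r)) fun s => B (p.1, s)

section Sigma
variable [Fintype ι] [∀ i, Fintype (κ i)]

theorem gram_ancillaSigma [Fintype X] (A : ∀ i, Matrix (X × κ i) n ℂ) :
    (ancillaSigma A)ᴴ * ancillaSigma A = ∑ i, (A i)ᴴ * A i := by
  ext p q
  simp only [Matrix.mul_apply, Matrix.sum_apply, Matrix.conjTranspose_apply, ancillaSigma,
    Matrix.of_apply, Fintype.sum_prod_type, Fintype.sum_sigma]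
  exact Finset.sum_comm

theorem reduced_ancillaSigma_mul [Fintype m] [Fintype R'] (A : ∀ i, Matrix (X × κ i) m ℂ)
    (Φ : Matrix m (Y × R') ℂ) :
    reduced (ancillaSigma A * Φ) = ∑ i, reduced (A i * Φ) := by
  ext p q
  simp only [reduced_apply, Matrix.sum_apply, Fintype.sum_sigma]
  rfl

theorem reduced_mul_ancillaSigma_transpose [Fintype n] [Fintype R] (B : ∀ i, Matrix (Y × κ i) n ℂ)
    (Φ : Matrix (X × R) n ℂ) :
    reduced (Φ * (ancillaSigma B)ᵀ) = ∑ i, reduced (Φ * (B i)ᵀ) := by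
  ext p q
  simp only [reduced_apply, Matrix.sum_apply, Fintype.sum_sigma]
  exact Finset.sum_comm

variable [DecidableEq ι]

theorem gram_ancillaSigma_single [Fintype X] (i : ι) (A : Matrix (X × κ i) n ℂ) :
    (ancillaSigma (Pi.single i A))ᴴ * ancillaSigma (Pi.single i A) = Aᴴ * A := by
  rw [gram_ancillaSigma, Fintype.sum_eq_single i fun j hj => by rw [Pi.single_eq_of_ne hj,
    Matrix.mul_zero], Pi.single_eq_same]

theorem reduced_ancillaSigma_single_mul [Fintype m] [Fintype R'] (i : ι) (A : Matrix (X × κ i) m ℂ)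
    (Φ : Matrix m (Y × R') ℂ) : reduced (ancillaSigma (Pi.single i A) * Φ) = reduced (A * Φ) := by
  rw [reduced_ancillaSigma_mul, Fintype.sum_eq_single i fun j hj => by rw [Pi.single_eq_of_ne hj,
    Matrix.zero_mul, reduced_zero], Pi.single_eq_same]

theorem reduced_mul_ancillaSigma_single_transpose [Fintype n] [Fintype R] (i : ι)
    (B : Matrix (Y × κ i) n ℂ) (Φ : Matrix (X × R) n ℂ) :
    reduced (Φ * (ancillaSigma (Pi.single i B))ᵀ) = reduced (Φ * Bᵀ) := by
  rw [reduced_mul_ancillaSigma_transpose, Fintype.sum_eq_single i fun j hj => by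
    rw [Pi.single_eq_of_ne hj, Matrix.transpose_zero, Matrix.mul_zero, reduced_zero],
    Pi.single_eq_same]

end Sigma

theorem gram_ancillaSum [Fintype X] [Fintype R] [Fintype S] (A : Matrix (X × R) n ℂ)
    (B : Matrix (X × S) n ℂ) : (ancillaSum A B)ᴴ * ancillaSum A B = Aᴴ * A + Bᴴ * B := by
  ext p q
  simp only [Matrix.mul_apply, Matrix.add_apply, Matrix.conjTranspose_apply, ancillaSum,
    Matrix.of_apply, Fintype.sum_prod_type, Fintype.sum_sum_type, Finset.sum_add_distrib,
    Sum.elim_inl, Sum.elim_inr]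

theorem reduced_ancillaSum_mul [Fintype m] [Fintype R] [Fintype S] [Fintype R']
    (A : Matrix (X × R) m ℂ) (B : Matrix (X × S) m ℂ) (Φ : Matrix m (Y × R') ℂ) :
    reduced (ancillaSum A B * Φ) = reduced (A * Φ) + reduced (B * Φ) := by
  ext p q
  simp only [reduced_apply, Matrix.add_apply, Fintype.sum_sum_type]
  rfl

theorem reduced_mul_ancillaSum_transpose [Fintype n] [Fintype R] [Fintype R'] [Fintype S']
    (A : Matrix (Y × R') n ℂ) (B : Matrix (Y × S') n ℂ) (Φ : Matrix (X × R) n ℂ) :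
    reduced (Φ * (ancillaSum A B)ᵀ) = reduced (Φ * Aᵀ) + reduced (Φ * Bᵀ) := by
  ext p q
  simp only [reduced_apply, Matrix.add_apply, Fintype.sum_sum_type, Finset.sum_add_distrib]
  rfl

end Ancilla

section Completion

variable {ι κ X Y R R' m n : Type*}

theorem eq_of_le_of_sum_trace_le [Fintype ι] [Fintype n] {A B : ι → Matrix n n ℂ}
    (h : ∀ i, A i ≤ B i) (htrace : ∑ i, (B i).trace ≤ ∑ i, (A i).trace) : A = B := by
  have hpos (i : ι) : (B i - A i).PosSemidef := Matrix.le_iff.1 (h i)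
  have hle (i : ι) : (A i).trace ≤ (B i).trace := by
    simpa only [Matrix.trace_sub, sub_nonneg] using (hpos i).trace_nonneg
  have heq := (Finset.sum_eq_sum_iff_of_le fun i _ => hle i).1
    ((Finset.sum_le_sum fun i _ => hle i).antisymm htrace)
  funext i
  have hzero := (hpos i).trace_eq_zero_iff.1 (by
    rw [Matrix.trace_sub, heq i (Finset.mem_univ i), sub_self])
  exact (sub_eq_zero.1 hzero).symm

theorem trace_reduced_mul_transpose_of_isometry [Fintype X] [Fintype Y] [Fintype R] [Fintype R']
    [Fintype n] [DecidableEq n] (Φ : Matrix (X × R) n ℂ) {V : Matrix (Y × R') n ℂ}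
    (hV : Vᴴ * V = 1) : (reduced (Φ * Vᵀ)).trace = (Φᴴ * Φ).trace := by
  calc _ = (Vᵀᴴ * (Φᴴ * Φ) * Vᵀ).trace := by
        rw [trace_reduced, Matrix.conjTranspose_mul]
        simp only [Matrix.mul_assoc]
    _ = ((Vᴴ * V)ᵀ * (Φᴴ * Φ)).trace := by
        rw [Matrix.trace_mul_cycle, Matrix.transpose_mul]
        rfl
    _ = (Φᴴ * Φ).trace := by rw [hV, Matrix.transpose_one, Matrix.one_mul]

theorem sum_trace_reduced [Fintype ι] [Fintype X] [Fintype Y] [Fintype R] [Fintype R'] [Fintype m]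
    [DecidableEq m] [Fintype n] [DecidableEq n] {M : ι → Matrix (X × R) m ℂ}
    {V : ι → Matrix (Y × R') n ℂ} (hM : ∑ i, (M i)ᴴ * M i = 1) (hV : ∀ i, (V i)ᴴ * V i = 1)
    (Ψ : Matrix m n ℂ) : ∑ i, (reduced (M i * Ψ * (V i)ᵀ)).trace = (Ψᴴ * Ψ).trace := by
  simp only [trace_reduced_mul_transpose_of_isometry _ (hV _), ← Matrix.trace_sum, sum_gram_mul, hM,
    Matrix.mul_one]

theorem exists_add_gram_eq_one [Fintype X] [Fintype n] [DecidableEq n]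
    (hX : Nonempty n → Nonempty X) {G : Matrix n n ℂ} (hG : G ≤ 1) :
    ∃ C : Matrix (X × n) n ℂ, G + Cᴴ * C = 1 := by
  classical
  rcases isEmpty_or_nonempty n with hn | hn
  · exact ⟨0, Subsingleton.elim _ _⟩
  · obtain ⟨x₀⟩ := hX hn
    obtain ⟨T, hT, hTG⟩ := exists_hermitian_mul_self_eq (sub_nonneg.2 hG)
    let C : Matrix (X × n) n ℂ := Matrix.of fun p => if p.1 = x₀ then T p.2 else 0
    have hC : Cᴴ * C = Tᴴ * T := by
      ext i j
      simp only [C, Matrix.mul_apply, Matrix.conjTranspose_apply, Matrix.of_apply,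
        Fintype.sum_prod_type]
      rw [Fintype.sum_eq_single x₀ fun x hx => by simp [hx]]
      simp
    exact ⟨C, by rw [hC, hT, hTG, add_sub_cancel]⟩

theorem reduced_mul_mul_transpose_le_ancillaSum {S S' : Type*} [Finite X] [Finite Y] [Fintype R]
    [Fintype R'] [Fintype S] [Fintype S'] [Fintype m] [Fintype n] (M : Matrix (X × R) m ℂ)
    (C : Matrix (X × S) m ℂ) (V : Matrix (Y × R') n ℂ) (E : Matrix (Y × S') n ℂ)
    (Ψ : Matrix m n ℂ) :
    reduced (M * Ψ * Vᵀ) ≤ reduced (ancillaSum M C * Ψ * (ancillaSum V E)ᵀ) := by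
  calc _ ≤ reduced (M * (Ψ * Vᵀ)) + reduced (C * (Ψ * Vᵀ)) := by
        rw [Matrix.mul_assoc]
        exact le_add_of_nonneg_right (reduced_nonneg _)
    _ = reduced (ancillaSum M C * Ψ * Vᵀ) := by rw [← reduced_ancillaSum_mul, Matrix.mul_assoc]
    _ ≤ reduced (ancillaSum M C * Ψ * Vᵀ) + reduced (ancillaSum M C * Ψ * Eᵀ) :=
        le_add_of_nonneg_right (reduced_nonneg _)
    _ = _ := (reduced_mul_ancillaSum_transpose _ _ _).symm

/-- Completing `M` and `V` can only add positive terms to the reduced states, and by `htrace` there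
is no trace left for them. -/
theorem exists_isometric_completion [Fintype ι] [Nonempty ι] [Fintype X] [Fintype Y] [Fintype R]
    [Fintype R'] [Fintype m] [DecidableEq m] [Fintype n] [DecidableEq n]
    (hX : Nonempty m → Nonempty X) (hY : Nonempty n → Nonempty Y) {M : ι → Matrix (X × R) m ℂ}
    {V : ι → Matrix (Y × R') n ℂ} {Ψ : Matrix m n ℂ} (hM : ∑ i, (M i)ᴴ * M i ≤ 1)
    (hV : ∀ i, (V i)ᴴ * V i ≤ 1)
    (htrace : ∑ i, (reduced (M i * Ψ * (V i)ᵀ)).trace = (Ψᴴ * Ψ).trace) :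
    ∃ (M' : ι → Matrix (X × (R ⊕ m)) m ℂ) (V' : ι → Matrix (Y × (R' ⊕ n)) n ℂ),
      ∑ i, (M' i)ᴴ * M' i = 1 ∧ (∀ i, (V' i)ᴴ * V' i = 1) ∧
      ∀ i, reduced (M' i * Ψ * (V' i)ᵀ) = reduced (M i * Ψ * (V i)ᵀ) := by
  classical
  obtain ⟨i₀⟩ := ‹Nonempty ι›
  obtain ⟨C, hC⟩ := exists_add_gram_eq_one hX hM
  choose E hE using fun i => exists_add_gram_eq_one hY (hV i)
  let C' : ι → Matrix (X × m) m ℂ := Pi.single i₀ C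
  have hM' : ∑ i, (ancillaSum (M i) (C' i))ᴴ * ancillaSum (M i) (C' i) = 1 := by
    have hsum : ∑ i, (C' i)ᴴ * C' i = Cᴴ * C := by
      rw [Fintype.sum_eq_single i₀ fun i hi => by simp [C', hi]]
      simp [C']
    simp only [gram_ancillaSum, Finset.sum_add_distrib, hsum, hC]
  have hV' (i : ι) : (ancillaSum (V i) (E i))ᴴ * ancillaSum (V i) (E i) = 1 := by
    rw [gram_ancillaSum, hE]
  refine ⟨fun i => ancillaSum (M i) (C' i), fun i => ancillaSum (V i) (E i), hM', hV',
    fun i => (congrFun (eq_of_le_of_sum_trace_le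
      (fun i => reduced_mul_mul_transpose_le_ancillaSum (M i) (C' i) (V i) (E i) Ψ) ?_) i).symm⟩
  exact ((sum_trace_reduced hM' hV' Ψ).trans htrace.symm).le

theorem exists_common_ancilla [Fintype ι] [Fintype κ] {A B : ι → Type*} [∀ i, Fintype (A i)]
    [∀ i, Fintype (B i)] [Fintype X] [Fintype Y] [Fintype m] [DecidableEq m] [Fintype n]
    [DecidableEq n] (e : ι ↪ κ) {M : ∀ i, Matrix (X × A i) m ℂ} {V : ∀ i, Matrix (Y × B i) n ℂ}
    (hM : ∑ i, (M i)ᴴ * M i ≤ 1) (hV : ∀ i, (V i)ᴴ * V i ≤ 1) (Ψ : Matrix m n ℂ) :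
    ∃ (M' : κ → Matrix (X × Σ i, A i) m ℂ) (V' : κ → Matrix (Y × Σ i, B i) n ℂ),
      ∑ k, (M' k)ᴴ * M' k ≤ 1 ∧ (∀ k, (V' k)ᴴ * V' k ≤ 1) ∧
      (∀ i, reduced (M' (e i) * Ψ * (V' (e i))ᵀ) = reduced (M i * Ψ * (V i)ᵀ)) ∧
      ∀ k ∉ Set.range e, reduced (M' k * Ψ * (V' k)ᵀ) = 0 := by
  classical
  let M' := Function.extend e (fun i => ancillaSigma (Pi.single i (M i))) 0
  let V' := Function.extend e (fun i => ancillaSigma (Pi.single i (V i))) 0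
  have hMe (i : ι) : M' (e i) = ancillaSigma (Pi.single i (M i)) := e.injective.extend_apply _ _ _
  have hVe (i : ι) : V' (e i) = ancillaSigma (Pi.single i (V i)) := e.injective.extend_apply _ _ _
  have hM0 (k : κ) (hk : k ∉ Set.range e) : M' k = 0 := Function.extend_apply' _ _ _ hk
  have hV0 (k : κ) (hk : k ∉ Set.range e) : V' k = 0 := Function.extend_apply' _ _ _ hk
  refine ⟨M', V', ?_, fun k => ?_, fun i => ?_, fun k hk => ?_⟩
  · refine le_of_eq_of_le (Fintype.sum_of_injective e e.injective _ _ (fun k hk => ?_)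
      fun i => ?_).symm hM
    · rw [hM0 k hk, Matrix.mul_zero]
    · rw [hMe, gram_ancillaSigma_single]
  · by_cases hk : k ∈ Set.range e
    · obtain ⟨i, rfl⟩ := hk
      rw [hVe, gram_ancillaSigma_single]
      exact hV i
    · rw [hV0 k hk, Matrix.mul_zero]
      exact zero_le_one
  · rw [hMe, hVe, reduced_mul_ancillaSigma_single_transpose, Matrix.mul_assoc,
      reduced_ancillaSigma_single_mul, Matrix.mul_assoc]
  · rw [hM0 k hk, Matrix.zero_mul, Matrix.zero_mul, reduced_zero]

end Completion

theorem sum_trace_conj {ι n : Type*} {κ : ι → Type*} {μ : ∀ i, κ i → Type*} [Fintype ι]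
    [∀ i, Fintype (κ i)] [∀ i j, Fintype (μ i j)] [Fintype n] [DecidableEq n]
    {A : ∀ i j, Matrix (μ i j) n ℂ} (hA : ∑ i, ∑ j, (A i j)ᴴ * A i j = 1) (ρ : Matrix n n ℂ) :
    ∑ i, ∑ j, (A i j * ρ * (A i j)ᴴ).trace = ρ.trace := by
  calc _ = ((∑ i, ∑ j, (A i j)ᴴ * A i j) * ρ).trace := by
        simp only [Matrix.sum_mul, Matrix.trace_sum]
        exact Finset.sum_congr rfl fun i _ => Finset.sum_congr rfl fun j _ =>
          Matrix.trace_mul_cycle _ _ _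
    _ = ρ.trace := by rw [hA, Matrix.one_mul]

namespace LocalOp

variable {m d : ℕ} {d' : Msg m → ℕ} (L : LocalOp m d d')

theorem sum_gram_kronecker_one (R : Type*) [Fintype R] [DecidableEq R] :
    ∑ o, ∑ i, (L.K o i ⊗ₖ (1 : Matrix R R ℂ))ᴴ * (L.K o i ⊗ₖ (1 : Matrix R R ℂ)) = 1 := by
  simp only [Matrix.conjTranspose_kronecker, Matrix.conjTranspose_one, ← Matrix.mul_kronecker_mul,
    Matrix.one_mul]
  rw [← Matrix.one_kronecker_one, ← L.complete]
  ext
  simp [Matrix.sum_apply, Finset.sum_mul]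

theorem sum_gram_one_kronecker (R : Type*) [Fintype R] [DecidableEq R] :
    ∑ o, ∑ i, ((1 : Matrix R R ℂ) ⊗ₖ L.K o i)ᴴ * ((1 : Matrix R R ℂ) ⊗ₖ L.K o i) = 1 := by
  simp only [Matrix.conjTranspose_kronecker, Matrix.conjTranspose_one, ← Matrix.mul_kronecker_mul,
    Matrix.one_mul]
  rw [← Matrix.one_kronecker_one, ← L.complete]
  ext
  simp [Matrix.sum_apply, Finset.mul_sum]

theorem sum_trace_onAlice {b : ℕ} (ρ : Matrix (Fin d × Fin b) (Fin d × Fin b) ℂ) :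
    ∑ o, (L.onAlice o ρ).trace = ρ.trace := by
  simp only [onAlice, Matrix.trace_sum, sum_trace_conj (L.sum_gram_kronecker_one (Fin b))]

theorem sum_trace_onBob {a : ℕ} (ρ : Matrix (Fin a × Fin d) (Fin a × Fin d) ℂ) :
    ∑ o, (L.onBob o ρ).trace = ρ.trace := by
  simp only [onBob, Matrix.trace_sum, sum_trace_conj (L.sum_gram_one_kronecker (Fin a))]

/-- The operator by which outcome `o` of a local operation is implemented coherently, in the
presence of a spectator `R`: the Kraus index is kept in the ancilla rather than forgotten. -/
def dilation (o : Msg m) (R : Type*) [DecidableEq R] :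
    Matrix (Fin (d' o) × Σ _ : Fin (L.rk o), R) (Fin d × R) ℂ :=
  ancillaSigma fun i => L.K o i ⊗ₖ (1 : Matrix R R ℂ)

theorem sum_gram_dilation (R : Type*) [Fintype R] [DecidableEq R] :
    ∑ o, (L.dilation o R)ᴴ * L.dilation o R = 1 := by
  simp only [dilation, gram_ancillaSigma, sum_gram_kronecker_one]

theorem onAlice_reduced {b : ℕ} {R R' : Type*} [Fintype R] [DecidableEq R] [Fintype R'] (o : Msg m)
    (Φ : Matrix (Fin d × R) (Fin b × R') ℂ) :
    L.onAlice o (reduced Φ) = reduced (L.dilation o R * Φ) := by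
  classical
  simp only [onAlice, dilation, reduced_ancillaSigma_mul, kronecker_conj_reduced,
    Matrix.one_kronecker_one, Matrix.transpose_one, Matrix.mul_one]

theorem onBob_reduced {a : ℕ} {R R' : Type*} [Fintype R] [Fintype R'] [DecidableEq R'] (o : Msg m)
    (Φ : Matrix (Fin a × R) (Fin d × R') ℂ) :
    L.onBob o (reduced Φ) = reduced (Φ * (L.dilation o R')ᵀ) := by
  classical
  simp only [onBob, dilation, reduced_mul_ancillaSigma_transpose, kronecker_conj_reduced,
    Matrix.one_kronecker_one, Matrix.one_mul]

end LocalOp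

namespace Protocol

variable {x y : ℕ}

instance instFintypeTranscript : {a b : ℕ} → (P : Protocol x y a b) → Fintype P.Transcript
  | _, _, done => inferInstanceAs (Fintype Unit)
  | _, _, alice (m := m) _ next =>
    letI := fun o => instFintypeTranscript (next o)
    inferInstanceAs (Fintype (Σ o : Msg m, (next o).Transcript))
  | _, _, bob (m := m) _ next =>
    letI := fun o => instFintypeTranscript (next o)
    inferInstanceAs (Fintype (Σ o : Msg m, (next o).Transcript))

theorem card_sigma_le_two_pow {m : ℕ} {T : Msg m → Type*} [∀ o, Fintype (T o)] {k : Msg m → ℕ}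
    (h : ∀ o, Fintype.card (T o) ≤ 2 ^ k o) :
    Fintype.card (Σ o, T o) ≤ 2 ^ (m + Finset.univ.sup k) := by
  calc Fintype.card (Σ o, T o) ≤ ∑ _o : Msg m, 2 ^ Finset.univ.sup k := by
        rw [Fintype.card_sigma]
        exact Finset.sum_le_sum fun o _ =>
          (h o).trans (Nat.pow_le_pow_right two_pos (Finset.le_sup (Finset.mem_univ o)))
    _ = 2 ^ (m + Finset.univ.sup k) := by simp [pow_add]

theorem card_transcript_le {a b : ℕ} (P : Protocol x y a b) :
    Fintype.card P.Transcript ≤ 2 ^ P.cost := by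
  induction P with
  | done => exact Fintype.card_unit.le
  | alice _ _ ih => exact card_sigma_le_two_pow ih
  | bob _ _ ih => exact card_sigma_le_two_pow ih

theorem sum_transcript_alice {E : Type*} [AddCommMonoid E] {a b m : ℕ} {a' : Msg m → ℕ}
    (L : LocalOp m a a') (next : (o : Msg m) → Protocol x y (a' o) b)
    (f : (alice L next).Transcript → E) : ∑ t, f t = ∑ o, ∑ t, f ⟨o, t⟩ :=
  Fintype.sum_sigma _

theorem sum_transcript_bob {E : Type*} [AddCommMonoid E] {a b m : ℕ} {b' : Msg m → ℕ}
    (L : LocalOp m b b') (next : (o : Msg m) → Protocol x y a (b' o))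
    (f : (bob L next).Transcript → E) : ∑ t, f t = ∑ o, ∑ t, f ⟨o, t⟩ :=
  Fintype.sum_sigma _

theorem output_alice {a b m : ℕ} {a' : Msg m → ℕ} (L : LocalOp m a a')
    (next : (o : Msg m) → Protocol x y (a' o) b) (ρ : Matrix (Fin a × Fin b) (Fin a × Fin b) ℂ)
    (o : Msg m) (t : (next o).Transcript) :
    (alice L next).output ρ ⟨o, t⟩ = (next o).output (L.onAlice o ρ) t :=
  rfl

theorem output_bob {a b m : ℕ} {b' : Msg m → ℕ} (L : LocalOp m b b')
    (next : (o : Msg m) → Protocol x y a (b' o)) (ρ : Matrix (Fin a × Fin b) (Fin a × Fin b) ℂ)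
    (o : Msg m) (t : (next o).Transcript) :
    (bob L next).output ρ ⟨o, t⟩ = (next o).output (L.onBob o ρ) t :=
  rfl

theorem sum_trace_output {a b : ℕ} (P : Protocol x y a b)
    (ρ : Matrix (Fin a × Fin b) (Fin a × Fin b) ℂ) : ∑ t, (P.output ρ t).trace = ρ.trace := by
  induction P with
  | done => exact Fintype.sum_unique (ι := Unit) fun _ => ρ.trace
  | alice L _ ih => simp only [sum_transcript_alice, output_alice, ih, L.sum_trace_onAlice]
  | bob L _ ih => simp only [sum_transcript_bob, output_bob, ih, L.sum_trace_onBob]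

theorem exists_one_way_simulation {a b : ℕ} {R R' : Type} [Fintype R] [DecidableEq R] [Fintype R']
    [DecidableEq R'] (P : Protocol x y a b) (Φ : Matrix (Fin a × R) (Fin b × R') ℂ) :
    ∃ (A B : P.Transcript → Type) (_ : ∀ t, Fintype (A t)) (_ : ∀ t, Fintype (B t))
      (M : ∀ t, Matrix (Fin x × A t) (Fin a × R) ℂ)
      (V : ∀ t, Matrix (Fin y × B t) (Fin b × R') ℂ),
      ∑ t, (M t)ᴴ * M t ≤ 1 ∧ (∀ t, (V t)ᴴ * V t ≤ 1) ∧
      ∀ t, P.output (reduced Φ) t = reduced (M t * Φ * (V t)ᵀ) := by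
  induction P generalizing R R' with
  | done =>
    refine ⟨fun _ => R, fun _ => R', fun _ => inferInstance, fun _ => inferInstance, fun _ => 1,
      fun _ => 1, ?_, fun _ => by simp, fun _ => by simp [output]⟩
    exact (Fintype.sum_unique (ι := Unit) _).trans_le (by simp)
  | alice L next ih =>
    choose A B _ _ M V hM hV h using fun o => ih o (L.dilation o R * Φ)
    refine ⟨fun t => A t.1 t.2, fun t => B t.1 t.2, fun t => inferInstance,
      fun t => inferInstance, fun t => M t.1 t.2 * L.dilation t.1 R,
      fun t => V t.1 t.2, ?_, fun t => hV _ _, fun ⟨o, t⟩ => ?_⟩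
    · calc _ = ∑ o, ∑ t, (M o t * L.dilation o R)ᴴ * (M o t * L.dilation o R) :=
            sum_transcript_alice L next _
        _ ≤ ∑ o, (L.dilation o R)ᴴ * L.dilation o R :=
            Finset.sum_le_sum fun o _ => sum_gram_mul_le (hM o) _
        _ ≤ 1 := (L.sum_gram_dilation R).le
    · rw [output_alice, L.onAlice_reduced, h]
      simp only [Matrix.mul_assoc]
  | bob L next ih =>
    obtain ⟨N, W, hN, hW, hNW⟩ := exists_swap_measurement Φ (L.sum_gram_dilation R').le
    choose A B _ _ M V hM hV h using fun o => ih o (Φ * (L.dilation o R')ᵀ)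
    refine ⟨fun t => A t.1 t.2, fun t => B t.1 t.2, fun t => inferInstance,
      fun t => inferInstance, fun t => M t.1 t.2 * N t.1,
      fun t => V t.1 t.2 * W t.1, ?_, fun t => ?_, fun ⟨o, t⟩ => ?_⟩
    · calc _ = ∑ o, ∑ t, (M o t * N o)ᴴ * (M o t * N o) := sum_transcript_bob L next _
        _ ≤ ∑ o, (N o)ᴴ * N o := Finset.sum_le_sum fun o _ => sum_gram_mul_le (hM o) _
        _ ≤ 1 := hN
    · exact gram_mul_le_one (hV _ _) (hW _)
    · rw [output_bob, L.onBob_reduced, h, hNW]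
      simp only [Matrix.transpose_mul, Matrix.mul_assoc]

end Protocol

section PureState

variable {a b : ℕ}

theorem pureState_vec_eq_reduced (Ψ : Matrix (Fin a) (Fin b) ℂ) :
    pureState Ψᵀ.vec =
      reduced (Ψ.submatrix Prod.fst Prod.fst : Matrix (Fin a × Unit) (Fin b × Unit) ℂ) := by
  ext p q
  simp [pureState, reduced_apply, Matrix.vecMulVec_apply, Matrix.vec]

theorem trace_pureState_vec (Ψ : Matrix (Fin a) (Fin b) ℂ) :
    (pureState Ψᵀ.vec).trace = (Ψᴴ * Ψ).trace := by
  rw [pureState, Matrix.trace_vecMulVec, dotProduct_comm, Matrix.star_vec_dotProduct_vec,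
    Matrix.trace_mul_comm, ← Matrix.trace_transpose (Ψᴴ * Ψ), Matrix.transpose_mul]
  rfl

theorem kronecker_conj_pureState_vec {a' b' : ℕ} (A : Matrix (Fin a') (Fin a) ℂ)
    (B : Matrix (Fin b') (Fin b) ℂ) (Ψ : Matrix (Fin a) (Fin b) ℂ) :
    (A ⊗ₖ B) * pureState Ψᵀ.vec * (A ⊗ₖ B)ᴴ = pureState (A * Ψ * Bᵀ)ᵀ.vec := by
  rw [pureState, Matrix.mul_vecMulVec, Matrix.vecMulVec_mul, ← Matrix.star_mulVec,
    Matrix.kronecker_mulVec_vec, pureState]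
  simp only [Matrix.transpose_mul, Matrix.transpose_transpose, Matrix.mul_assoc]

theorem Protocol.exists_pureState_simulation {x y : ℕ} (P : Protocol x y a b)
    (Ψ : Matrix (Fin a) (Fin b) ℂ) :
    ∃ (A B : P.Transcript → Type) (_ : ∀ t, Fintype (A t)) (_ : ∀ t, Fintype (B t))
      (M : ∀ t, Matrix (Fin x × A t) (Fin a) ℂ) (V : ∀ t, Matrix (Fin y × B t) (Fin b) ℂ),
      ∑ t, (M t)ᴴ * M t ≤ 1 ∧ (∀ t, (V t)ᴴ * V t ≤ 1) ∧
      ∀ t, P.output (pureState Ψᵀ.vec) t = reduced (M t * Ψ * (V t)ᵀ) := by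
  let J (d : ℕ) : Matrix (Fin d × Unit) (Fin d) ℂ := (1 : Matrix _ _ ℂ).submatrix Prod.fst id
  have hJ (d : ℕ) : (J d)ᴴ * J d = 1 := by
    ext i j
    simp [J, Matrix.mul_apply, Fintype.sum_prod_type, Matrix.one_apply, apply_ite]
  have hΨ : Ψ.submatrix Prod.fst Prod.fst = J a * Ψ * (J b)ᵀ := by
    ext p q
    simp [J, Matrix.mul_apply, Matrix.one_apply]
  obtain ⟨A, B, _, _, M, V, hM, hV, hout⟩ :=
    P.exists_one_way_simulation (Ψ.submatrix Prod.fst Prod.fst : Matrix (_ × Unit) (_ × Unit) ℂ)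
  refine ⟨A, B, inferInstance, inferInstance, fun t => M t * J a, fun t => V t * J b,
    (sum_gram_mul_le hM _).trans (hJ a).le, fun t => gram_mul_le_one (hV t) (hJ b).le, fun t => ?_⟩
  rw [pureState_vec_eq_reduced, hout, hΨ]
  simp only [Matrix.transpose_mul, Matrix.mul_assoc]

end PureState

section Dimension

theorem LocalOp.exists_pos {m d : ℕ} {d' : Msg m → ℕ} (L : LocalOp m d d') (hd : 0 < d) :
    ∃ o, 0 < d' o := by
  have := Fin.pos_iff_nonempty.1 hd
  obtain ⟨o, ho⟩ := exists_nonempty_of_sum_gram_eq_one (L.sum_gram_dilation Unit)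
  exact ⟨o, Fin.pos_iff_nonempty.2 (ho.map Prod.fst)⟩

variable {x y a b : ℕ}

theorem Protocol.left_pos (P : Protocol x y a b) (ha : 0 < a) : 0 < x := by
  induction P with
  | done => exact ha
  | alice L _ ih =>
    obtain ⟨o, ho⟩ := L.exists_pos ha
    exact ih o ho
  | bob _ _ ih => exact ih default ha

theorem Protocol.right_pos (P : Protocol x y a b) (hb : 0 < b) : 0 < y := by
  induction P with
  | done => exact hb
  | alice _ _ ih => exact ih default hb
  | bob L _ ih =>
    obtain ⟨o, ho⟩ := L.exists_pos hb
    exact ih o ho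

theorem Protocol.exists_measurement_isometry_simulation {κ : Type} [Fintype κ] [Nonempty κ]
    (P : Protocol x y a b) (e : P.Transcript ↪ κ) (Ψ : Matrix (Fin a) (Fin b) ℂ) :
    ∃ (R R' : Type) (_ : Fintype R) (_ : Fintype R')
      (M : κ → Matrix (Fin x × R) (Fin a) ℂ) (V : κ → Matrix (Fin y × R') (Fin b) ℂ),
      ∑ k, (M k)ᴴ * M k = 1 ∧ (∀ k, (V k)ᴴ * V k = 1) ∧
      (∀ t, reduced (M (e t) * Ψ * (V (e t))ᵀ) = P.output (pureState Ψᵀ.vec) t) ∧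
      ∀ k ∉ Set.range e, reduced (M k * Ψ * (V k)ᵀ) = 0 := by
  obtain ⟨A, B, _, _, M₀, V₀, hM₀, hV₀, hout⟩ := P.exists_pureState_simulation Ψ
  obtain ⟨M₁, V₁, hM₁, hV₁, hrange, hzero⟩ := exists_common_ancilla e hM₀ hV₀ Ψ
  have htrace : ∑ k, (reduced (M₁ k * Ψ * (V₁ k)ᵀ)).trace = (Ψᴴ * Ψ).trace := by
    rw [← trace_pureState_vec, ← P.sum_trace_output]
    refine (Fintype.sum_of_injective e e.injective _ _ (fun k hk => ?_) fun t => ?_).symm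
    · rw [hzero k hk, Matrix.trace_zero]
    · rw [hrange, hout]
  obtain ⟨M, V, hM, hV, hMV⟩ := exists_isometric_completion
    (by simpa only [← Fin.pos_iff_nonempty] using P.left_pos)
    (by simpa only [← Fin.pos_iff_nonempty] using P.right_pos) hM₁ hV₁ htrace
  exact ⟨_, _, inferInstance, inferInstance, M, V, hM, hV,
    fun t => by rw [hMV, hrange, hout], fun k hk => by rw [hMV, hzero k hk]⟩

end Dimension

section Flatten

variable {x y : ℕ} {R R' m n : Type*} [Fintype R] [Fintype R']

/-- An operator with output system `Fin x` and ancilla `R`, with the pairs numbered by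
`finProdFinEquiv`, as the definition of a standard form requires. -/
def flatten (A : Matrix (Fin x × R) n ℂ) : Matrix (Fin (x * Fintype.card R)) n ℂ :=
  A.submatrix (Prod.map id (Fintype.equivFin R).symm ∘ finProdFinEquiv.symm) id

theorem gram_flatten (A : Matrix (Fin x × R) n ℂ) : (flatten A)ᴴ * flatten A = Aᴴ * A :=
  Matrix.submatrix_mul_equiv Aᴴ A id
    (finProdFinEquiv.symm.trans ((Equiv.refl _).prodCongr (Fintype.equivFin R).symm)) id

theorem reduced_flatten [Fintype m] [Fintype n] (A : Matrix (Fin x × R) m ℂ)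
    (B : Matrix (Fin y × R') n ℂ) (Ψ : Matrix m n ℂ) :
    reduced ((flatten A * Ψ * (flatten B)ᵀ).submatrix finProdFinEquiv finProdFinEquiv) =
      reduced (A * Ψ * Bᵀ) := by
  rw [← reduced_reindex (Fintype.equivFin R).symm (Fintype.equivFin R').symm]
  congr 1
  ext p q
  simp [flatten, Matrix.mul_apply]

end Flatten

theorem mul_tensorBasis {m : Type*} {d n : ℕ} (i : Fin n) (A : Matrix m (Fin (d * n)) ℂ) :
    A * tensorBasis d i = A.submatrix id fun s => finProdFinEquiv (s, i) := by
  ext p s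
  simp [Matrix.mul_apply, tensorBasis]

theorem exists_unitary_implementation {y b : ℕ} {ι R' : Type} [Nonempty ι] [Fintype R']
    {V : ι → Matrix (Fin y × R') (Fin b) ℂ} (hV : ∀ k, (V k)ᴴ * V k = 1) :
    ∃ (S : Type) (_ : Fintype S) (W : ι → Matrix (Fin y × S) (Fin b) ℂ) (n : ℕ) (i : Fin n)
      (U : ι → Matrix (Fin (y * Fintype.card S)) (Fin (b * n)) ℂ),
      (∀ k, (U k)ᴴ * U k = 1) ∧ (∀ k, U k * (U k)ᴴ = 1) ∧
      (∀ k, U k * tensorBasis b i = flatten (W k)) ∧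
      ∀ (k : ι) {X R : Type} [Fintype R] (Φ : Matrix (X × R) (Fin b) ℂ),
        reduced (Φ * (W k)ᵀ) = reduced (Φ * (V k)ᵀ) := by
  rcases b.eq_zero_or_pos with rfl | hb
  · have : IsEmpty (Fin (0 * 1)) := by rw [zero_mul]; infer_instance
    have : IsEmpty (Fin (y * Fintype.card Empty)) := by
      rw [Fintype.card_empty, mul_zero]; infer_instance
    refine ⟨Empty, inferInstance, 0, 1, 0, 0, fun k => Subsingleton.elim _ _,
      fun k => Subsingleton.elim _ _, fun k => Subsingleton.elim _ _, fun k X R _ Φ => ?_⟩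
    rw [Subsingleton.elim Φ 0, Matrix.zero_mul, Matrix.zero_mul, reduced_zero, reduced_zero]
  · obtain ⟨u⟩ : Nonempty (Fin (y * Fintype.card R')) := by
      obtain ⟨k⟩ := ‹Nonempty ι›
      have := Fin.pos_iff_nonempty.1 hb
      exact (exists_nonempty_of_sum_gram_eq_one (ι := Unit) (A := fun _ => flatten (V k))
        (by simp [gram_flatten, hV])).choose_spec
    let W (k : ι) : Matrix (Fin y × Σ _ : Fin b, R') (Fin b) ℂ :=
      ancillaSigma (Pi.single ⟨0, hb⟩ (V k))
    have hW (k : ι) : (flatten (W k))ᴴ * flatten (W k) = 1 := by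
      rw [gram_flatten, gram_ancillaSigma_single, hV]
    choose U hU hU' hUW using fun k => exists_unitary_extension (hW k)
      (f := ⟨fun s => finProdFinEquiv (s, u), fun s t h => by simpa using h⟩) (by simp; ring)
    refine ⟨_, inferInstance, W, _, u, U, hU, hU', fun k => ?_, fun k X R _ Φ =>
      reduced_mul_ancillaSigma_single_transpose _ _ Φ⟩
    rw [mul_tensorBasis]
    exact hUW k

theorem sum_pureState_discard {x y N N' : ℕ} (Φ : Matrix (Fin (x * N)) (Fin (y * N')) ℂ) :
    ∑ j : Fin N', ∑ i : Fin N, pureState ((tensorBasis x i)ᴴ * Φ * ((tensorBasis y j)ᴴ)ᵀ)ᵀ.vec =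
      reduced (Φ.submatrix finProdFinEquiv finProdFinEquiv) := by
  ext p q
  rw [Finset.sum_comm]
  simp [reduced_apply, Matrix.sum_apply, pureState, Matrix.vecMulVec_apply, Matrix.vec,
    Matrix.mul_apply, tensorBasis]

namespace StandardForm

variable {x y a b c : ℕ} (S : StandardForm x y a b c)

/-- The transcript of a protocol in standard form in which Alice sends `k`. -/
def transcript (k : Msg c) : S.toProtocol.Transcript :=
  (⟨k, default, default, default, default, ()⟩ : Σ _ : Msg c, Σ _ : Msg 0, Σ _ : Msg 0,
    Σ _ : Msg 0, Σ _ : Msg 0, Unit)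

theorem transcript_injective : Function.Injective S.transcript := fun _ _ h =>
  congrArg Sigma.fst h

theorem transcript_surjective : Function.Surjective S.transcript := by
  rintro ⟨k, o₁, o₂, o₃, o₄, ⟨⟩⟩
  refine ⟨k, ?_⟩
  rw [Subsingleton.elim o₁ default, Subsingleton.elim o₂ default, Subsingleton.elim o₃ default,
    Subsingleton.elim o₄ default]
  rfl

theorem cost_toProtocol : S.toProtocol.cost = c := by
  simp [toProtocol, Protocol.cost]

theorem output_transcript (Ψ : Matrix (Fin a) (Fin b) ℂ) (k : Msg c) :
    S.toProtocol.output (pureState Ψᵀ.vec) (S.transcript k) =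
      reduced ((S.M k * Ψ * (S.U k * tensorBasis b S.init)ᵀ).submatrix
        finProdFinEquiv finProdFinEquiv) := by
  rw [← sum_pureState_discard]
  simp only [toProtocol, transcript, Protocol.output, LocalOp.onAlice, LocalOp.onBob,
    LocalOp.measurement, LocalOp.addAncilla, LocalOp.isometry, LocalOp.discard,
    Finset.univ_unique, Finset.sum_singleton, kronecker_conj_pureState_vec,
    Matrix.transpose_one, Matrix.mul_one, Matrix.one_mul, Matrix.mul_sum, Matrix.sum_mul]
  simp only [Matrix.transpose_mul, Matrix.mul_assoc]

end StandardForm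

theorem exists_standardForm {x y a b c : ℕ} {R R' : Type} [Fintype R] [Fintype R']
    {M : Msg c → Matrix (Fin x × R) (Fin a) ℂ} {V : Msg c → Matrix (Fin y × R') (Fin b) ℂ}
    (hM : ∑ k, (M k)ᴴ * M k = 1) (hV : ∀ k, (V k)ᴴ * V k = 1) :
    ∃ S : StandardForm x y a b c, ∀ (Ψ : Matrix (Fin a) (Fin b) ℂ) (k : Msg c),
      S.toProtocol.output (pureState Ψᵀ.vec) (S.transcript k) = reduced (M k * Ψ * (V k)ᵀ) := by
  obtain ⟨_, _, W, n, i, U, hU, hU', hUW, hWV⟩ := exists_unitary_implementation hV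
  refine ⟨⟨_, _, n, i, fun k => flatten (M k), ?_, U, hU, hU'⟩, fun Ψ k => ?_⟩
  · simpa only [gram_flatten] using hM
  · rw [StandardForm.output_transcript, hUW, reduced_flatten, hWV]

end LOCC

end

theorem claim1_general {x y a b : ℕ} (ψ : Fin a × Fin b → ℂ)
    (P : LOCC.Protocol x y a b) (c : ℕ) (hP : P.cost ≤ c) :
    ∃ S : LOCC.StandardForm x y a b c,
      S.toProtocol.cost = c ∧
      ∃ enc : P.Transcript → S.toProtocol.Transcript,
        Function.Injective enc ∧
        (∀ t, S.toProtocol.output (LOCC.pureState ψ) (enc t) =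
          P.output (LOCC.pureState ψ) t) ∧
        (∀ s, s ∉ Set.range enc → S.toProtocol.output (LOCC.pureState ψ) s = 0) := by
  obtain ⟨Ψ, rfl⟩ : ∃ Ψ : Matrix (Fin a) (Fin b) ℂ, Ψᵀ.vec = ψ :=
    ⟨Matrix.of fun i j => ψ (i, j), rfl⟩
  obtain ⟨e⟩ : Nonempty (P.Transcript ↪ LOCC.Msg c) :=
    Function.Embedding.nonempty_of_card_le <| P.card_transcript_le.trans <| by
      simpa using Nat.pow_le_pow_right two_pos hP
  obtain ⟨_, _, _, _, M, V, hM, hV, hMV, hMV'⟩ := P.exists_measurement_isometry_simulation e Ψ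
  obtain ⟨S, hS⟩ := LOCC.exists_standardForm hM hV
  refine ⟨S, S.cost_toProtocol, S.transcript ∘ e, S.transcript_injective.comp e.injective,
    fun t => (hS Ψ (e t)).trans (hMV t), fun s hs => ?_⟩
  obtain ⟨k, rfl⟩ := S.transcript_surjective s
  rw [hS]
  exact hMV' k fun ⟨t, ht⟩ => hs ⟨t, congrArg S.transcript ht⟩

theorem claim1 {x y a b : ℕ} (ψ : Fin a × Fin b → ℂ) (hψ : ∑ p, ‖ψ p‖ ^ 2 = 1)
    (P : LOCC.Protocol x y a b) (c : ℕ) (hP : P.cost ≤ c) :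
    ∃ S : LOCC.StandardForm x y a b c,
      S.toProtocol.cost = c ∧
      ∃ enc : P.Transcript → S.toProtocol.Transcript,
        Function.Injective enc ∧
        (∀ t, S.toProtocol.output (LOCC.pureState ψ) (enc t) =
          P.output (LOCC.pureState ψ) t) ∧
        (∀ s, s ∉ Set.range enc → S.toProtocol.output (LOCC.pureState ψ) s = 0) :=
  claim1_general ψ P c hP
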